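/- **Conventions.** For a set $X$ of ordinals, $[X]^\omega$ is the set of all countable subsets of $X$. A set $C\subseteq[X]^\omega$ is *club* if every $x\in[X]^\omega$ is contained in some $y\in C$ and $C$ is closed under unions of increasing countable chains; $S\subseteq[X]^\omega$ is *stationary* (in $[X]^\omega$) if it meets every club of $[X]^\omega$. A cardinal $\kappa$ is identified with the set of ordinals below it. If $x\cap\omega_1$ is a countable ordinal, that ordinal is denoted $\delta_x$; a condition on $\delta_x$ includes the requirement that it is defined. For $B\subseteq\omega_1$, "stationary" and "club" have the usual meaning. An *$\omega_1$-chain* in $[\kappa]^\omega$ is a sequence $\langle N_\alpha\mid\alpha<\omega_1\rangle$ of members of $[\kappa]^\omega$, increasing under inclusion, continuous ($N_\alpha=\bigcup_{\beta<\alpha}N_\beta$ for limit $\alpha$), such that all $\delta_{N_\alpha}$ are defined and $\delta_{N_\alpha}<\delta_{N_\beta}$ for $\alpha<\beta$. $S\subseteq[\kappa]^\omega$ is *projective stationary* if $\{x\in S\mid\delta_x\in B\}$ is stationary in $[\kappa]^\omega$ for every stationary $B\subseteq\omega_1$, and *projective stationary above* $A\subseteq\omega_1$ if this holds for every stationary $B\subseteq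 A$. * **SRP**: for every cardinal $\kappa>\omega_1$, every projective stationary $S\subseteq[\kappa]^\omega$ contains an $\omega_1$-chain (all of whose members are in $S$). * **WRP**: for every cardinal $\kappa>\omega_1$ and every stationary $S\subseteq[\kappa]^\omega$ there is $X\subseteq\kappa$ with $|X|=\aleph_1$ and $\omega_1\subseteq X$ such that $S\cap[X]^\omega$ is stationary in $[X]^\omega$. For a stationary $S\subseteq[\kappa]^\omega$, say that $A$ is a *trace* of $S$ if $A\subseteq\omega_1$ is stationary, $S$ is projective stationary above $A$, and $\{x\in S\mid\delta_x\notin A\}$ is not stationary. **Corollary 6.4.** Assume SRP. Then WRP holds. Moreover, for every cardinal $\kappa>\omega_1$ and every stationary $S\subseteq[\kappa]^\omega$: 1. there are a trace $A_S$ of $S$, a set $X$ with $|X|=\aleph_1$ and $\omega_1\subseteq X$, and an $\omega_1$-chain $\langle N_\alpha\mid\alpha<\omega_1\rangle$ in $[\kappa]^\omega$ with $\delta_{N_\alpha}=\alpha$ for all $\alpha<\omega_1$, such that $X=\bigcup_{\alpha<\omega_1}N_\alpha$ and $N_\alpha\in S$ for every $\alpha\in A_S$; 2. for every trace $A$ of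 $S$ there are a club $D\subseteq\omega_1$ and $X$, $\langle N_\alpha\mid\alpha<\omega_1\rangle$ as in 1, with $N_\alpha\in S$ for every $\alpha\in A\cap D$. -/

import Mathlib

open Set Cardinal Ordinal Order

universe u

namespace Reflection

/-- The well-ordered set `ω₁` of countable ordinals. -/
abbrev Omega1 : Type (u + 1) := Iio (ω₁ : Ordinal.{u})

/-- The cardinal `κ` as a set of ordinals. -/
abbrev base (κ : Cardinal.{u}) : Set Ordinal.{u} := Iio κ.ord

/-- The space `[X]^ω` of all countable subsets of `X`. -/
def countableSubsets (X : Set Ordinal.{u}) : Set (Set Ordinal.{u}) :=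
  {x | x ⊆ X ∧ x.Countable}

/-- `C` is closed unbounded in `[X]^ω`. Closure under unions of increasing `ω`-sequences is the same
as closure under unions of nonempty countable chains, since such a chain has a cofinal
`ω`-sequence. -/
structure IsClubIn (X : Set Ordinal.{u}) (C : Set (Set Ordinal.{u})) : Prop where
  subset : C ⊆ countableSubsets X
  closed : ∀ f : ℕ → Set Ordinal.{u}, Monotone f → (∀ n, f n ∈ C) → (⋃ n, f n) ∈ C
  cofinal : ∀ x ∈ countableSubsets X, ∃ y ∈ C, x ⊆ y

/-- `S` is a stationary subset of `[X]^ω`. -/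
def IsStationaryIn (X : Set Ordinal.{u}) (S : Set (Set Ordinal.{u})) : Prop :=
  S ⊆ countableSubsets X ∧ ∀ C, IsClubIn X C → (S ∩ C).Nonempty

/-- `x ∩ ω₁` is the countable ordinal `δ`; that is, `δ_x` is defined and equal to `δ`. -/
def HasDelta (x : Set Ordinal.{u}) (δ : Omega1.{u}) : Prop :=
  x ∩ Iio ω₁ = Iio (δ : Ordinal.{u})

/-- The part of `S` above `A`, namely `{x ∈ S | δ_x ∈ A}`. -/
def above (S : Set (Set Ordinal.{u})) (A : Set Omega1.{u}) : Set (Set Ordinal.{u}) :=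
  {x ∈ S | ∃ δ ∈ A, HasDelta x δ}

/-- An `ω₁`-chain in `[X]^ω`: a continuous increasing chain `⟨N_α | α < ω₁⟩` such that
`δ_{N_α} < δ_{N_β}` whenever `α < β`. -/
structure IsOmega1Chain (X : Set Ordinal.{u}) (N : Omega1.{u} → Set Ordinal.{u}) : Prop where
  mem : ∀ α, N α ∈ countableSubsets X
  mono : Monotone N
  continuous : ∀ α, IsSuccLimit α → N α = ⋃ β ∈ Iio α, N β
  delta_lt : ∃ d : Omega1.{u} → Omega1.{u}, StrictMono d ∧ ∀ α, HasDelta (N α) (d α)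

/-- `S ⊆ [κ]^ω` is projective stationary. -/
def IsProjectiveStationary (κ : Cardinal.{u}) (S : Set (Set Ordinal.{u})) : Prop :=
  S ⊆ countableSubsets (base κ) ∧
    ∀ A : Set Omega1.{u}, IsStationary A → IsStationaryIn (base κ) (above S A)

/-- `S ⊆ [κ]^ω` is projective stationary above `A ⊆ ω₁`. -/
def IsProjectiveStationaryAbove (κ : Cardinal.{u}) (A : Set Omega1.{u})
    (S : Set (Set Ordinal.{u})) : Prop :=
  S ⊆ countableSubsets (base κ) ∧
    ∀ B : Set Omega1.{u}, IsStationary B → B ⊆ A → IsStationaryIn (base κ) (above S B)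

/-- The Strong Reflection Principle. -/
def SRP : Prop :=
  ∀ κ : Cardinal.{u}, ℵ₁ < κ → ∀ S : Set (Set Ordinal.{u}), IsProjectiveStationary κ S →
    ∃ N : Omega1.{u} → Set Ordinal.{u}, IsOmega1Chain (base κ) N ∧ ∀ α, N α ∈ S

/-- The Weak Reflection Principle at `κ`. -/
def WRPAt (κ : Cardinal.{u}) : Prop :=
  ∀ S : Set (Set Ordinal.{u}), IsStationaryIn (base κ) S →
    ∃ X : Set Ordinal.{u}, X ⊆ base κ ∧ #X = ℵ₁ ∧ Iio ω₁ ⊆ X ∧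
      IsStationaryIn X (S ∩ countableSubsets X)

/-- The Weak Reflection Principle. -/
def WRP : Prop := ∀ κ : Cardinal.{u}, ℵ₁ < κ → WRPAt κ

/-- `A` is a trace of `S` (a representative of `A_S`): a stationary `A ⊆ ω₁` such that `S` is projective stationary
above `A` and `{x ∈ S | δ_x ∉ A}` is nonstationary. -/
structure IsTrace (κ : Cardinal.{u}) (S : Set (Set Ordinal.{u})) (A : Set Omega1.{u}) : Prop where
  stationary : IsStationary A
  projective : IsProjectiveStationaryAbove κ A S
  nonstationary : ¬ IsStationaryIn (base κ) (above S Aᶜ)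

/-- `X` has size `ℵ₁`, contains `ω₁`, and is the union of an `ω₁`-chain `⟨N_α⟩` in `[κ]^ω` with
`δ_{N_α} = α` for all `α < ω₁` and `N_α ∈ S` for all `α ∈ A`. -/
structure IsChainThrough (κ : Cardinal.{u}) (S : Set (Set Ordinal.{u})) (A : Set Omega1.{u})
    (X : Set Ordinal.{u}) (N : Omega1.{u} → Set Ordinal.{u}) : Prop where
  card : #X = ℵ₁
  omega1_subset : Iio ω₁ ⊆ X
  chain : IsOmega1Chain (base κ) N
  delta : ∀ α, HasDelta (N α) α
  union : X = ⋃ α, N α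
  mem : ∀ α ∈ A, N α ∈ S

end Reflection

namespace Reflection

/-! Fix a stationary `S`. The sets `B ⊆ ω₁` for which `{x ∈ S | δ_x ∈ B}` is nonstationary form a
normal ideal containing the nonstationary sets (`not_isStationaryIn_above_diagonal`). A trace is the
complement of a largest member of this ideal modulo nonstationary sets. Such a member exists because
SRP makes the nonstationary ideal saturated (`SRP.exists_enumeration`): a maximal antichain of
stationary sets in the ideal is listed in type `ω₁`, and its diagonal union stays in the ideal by
normality and is largest by maximality (`SRP.exists_isTrace`). Given a trace `A`, adding to `S`
every `x` with `δ_x ∉ A` yields a projective stationary set. An `ω₁`-chain in it has `δ_{N_α} = α`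
on a club `D`, which forces `N_α ∈ S` for `α ∈ A ∩ D`; off `D` the countable part of `N_α` is reset
(`SRP.exists_isChainThrough`). Any club of `[X]^ω`, where `X` is the union of the chain, contains
`N_α` for club many `α`, so `S` reflects to `X` (`IsChainThrough.isStationaryIn`). -/

/-! ### Clubs and diagonal intersections on `ω₁` -/

instance : Nonempty Omega1.{u} := ⟨⟨0, Ordinal.omega_pos 1⟩⟩

theorem cof_omega1_eq : cof Omega1.{u} = ℵ₁ := by simp

theorem cof_omega1_ne : cof Omega1.{u} ≠ ℵ₀ := by
  rw [cof_omega1_eq]; exact aleph0_lt_aleph_one.ne'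

theorem mk_omega1 : #Omega1.{u} = ℵ₁ := by simp

instance : NoMaxOrder Omega1.{u} :=
  ⟨fun a ↦ ⟨⟨succ a.1, (isSuccLimit_omega 1).succ_lt a.2⟩, Order.lt_succ a.1⟩⟩

theorem countable_Iio_of_lt {o : Ordinal.{u}} (h : o < ω₁) : (Iio o).Countable := by
  rw [← le_aleph0_iff_set_countable, Cardinal.mk_Iio_ordinal, lift_le_aleph0,
    ← Order.lt_succ_iff, succ_aleph0, ← lt_ord]
  simpa using h

theorem omega1_countable_Iio (a : Omega1.{u}) : (Iio a).Countable := by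
  have h : (Iio a) = Subtype.val ⁻¹' (Iio a.1) := rfl
  rw [h]
  exact (countable_Iio_of_lt a.2).preimage Subtype.val_injective

theorem exists_lt_of_countable {s : Set Omega1.{u}} (hs : s.Countable) : ∃ a, ∀ b ∈ s, b < a := by
  refine not_isCofinal_iff.1 fun h ↦ ?_
  have := cof_le h
  rw [cof_omega1_eq] at this
  exact absurd (this.trans (le_aleph0_iff_set_countable.2 hs)) aleph0_lt_aleph_one.not_ge

theorem exists_isLUB_of_countable {s : Set Omega1.{u}} (hs : s.Countable) : ∃ a, IsLUB s a := by
  obtain ⟨b, hb⟩ := exists_lt_of_countable hs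
  have hne : (upperBounds s).Nonempty := ⟨b, fun x hx ↦ (hb x hx).le⟩
  exact ⟨WellFounded.min wellFounded_lt _ hne, WellFounded.min_mem wellFounded_lt _ hne,
    fun c hc ↦ WellFounded.min_le wellFounded_lt hc⟩

/-- A step function `next` on `ω₁` has arbitrarily large `ω`-limits of its iterates. -/
theorem exists_isLUB_iterate (next : Omega1.{u} → Omega1.{u}) (hnext : ∀ a, a < next a)
    (a : Omega1.{u}) :
    ∃ (s : ℕ → Omega1.{u}) (b : Omega1.{u}), s 0 = a ∧ StrictMono s ∧
      (∀ n, s (n + 1) = next (s n)) ∧ IsLUB (range s) b := by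
  let s : ℕ → Omega1.{u} := fun n ↦ next^[n] a
  have hs : ∀ n, s (n + 1) = next (s n) := fun n ↦ Function.iterate_succ_apply' _ _ _
  obtain ⟨b, hb⟩ := exists_isLUB_of_countable (countable_range s)
  exact ⟨s, b, rfl, strictMono_nat_of_lt_succ fun n ↦ hs n ▸ hnext _, hs, hb⟩

theorem isClub_Ioi (a : Omega1.{u}) : IsClub (Ioi a) := by
  refine ⟨fun d hd ⟨x, hx⟩ _ b hb ↦ (hd hx).trans_le (hb.1 hx), fun b ↦ ?_⟩
  obtain ⟨c, hc⟩ := exists_gt (max a b)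
  exact ⟨c, (le_max_left _ _).trans_lt hc, ((le_max_right _ _).trans_lt hc).le⟩

/-- For unboundedness, iterate a map sending `a` into all `C b` with `b ≤ a`: for each `c` below the
limit, a tail of the iterates lies in `C c`. -/
theorem isClub_diagonal {C : Omega1.{u} → Set Omega1.{u}} (hC : ∀ a, IsClub (C a)) :
    IsClub {a | ∀ b < a, a ∈ C b} := by
  refine ⟨fun d hd hne hdir a ha b hb ↦ ?_, fun a ↦ ?_⟩
  · obtain ⟨c, hc, hbc⟩ := (lt_isLUB_iff ha).1 hb
    refine (hC b).isLUB_mem (t := d ∩ Ici c) (fun e he ↦ hd he.1 b (hbc.trans_le he.2))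
      ⟨c, hc, mem_Ici.2 le_rfl⟩ ⟨fun e he ↦ ha.1 he.1, fun e he ↦ ha.2 fun x hx ↦ ?_⟩
    obtain ⟨y, hy, hxy, hcy⟩ := hdir x hx c hc
    exact hxy.trans (he ⟨hy, hcy⟩)
  · have key : ∀ a : Omega1.{u}, ∃ c, a < c ∧ ∀ b ≤ a, c ∈ C b := by
      intro a
      have hcount : (Iic a).Countable := by
        rw [← Iio_union_right]; exact (omega1_countable_Iio a).union (countable_singleton a)
      have := hcount.to_subtype
      have hcl : IsClub ((⋂ b : Iic a, C b) ∩ Ioi a) :=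
        (IsClub.iInter_of_countable cof_omega1_ne fun b : Iic a ↦ hC b).inter
          cof_omega1_ne (isClub_Ioi a)
      obtain ⟨c, hc, -⟩ := hcl.isCofinal a
      exact ⟨c, hc.2, fun b hb ↦ mem_iInter.1 hc.1 ⟨b, hb⟩⟩
    choose next hnext hnextC using key
    obtain ⟨s, b, rfl, hmono, hs, hb⟩ := exists_isLUB_iterate next hnext a
    refine ⟨b, fun c hc ↦ ?_, hb.1 ⟨0, rfl⟩⟩
    obtain ⟨_, ⟨n, rfl⟩, hn⟩ := (lt_isLUB_iff hb).1 hc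
    refine (hC c).isLUB_mem (t := range fun k ↦ s (n + k + 1)) ?_ (range_nonempty _) ⟨?_, ?_⟩
    · rintro _ ⟨k, rfl⟩
      simp only [hs]
      exact hnextC _ _ (hn.le.trans (hmono.monotone (Nat.le_add_right _ _)))
    · rintro _ ⟨k, rfl⟩
      exact hb.1 ⟨_, rfl⟩
    · refine fun e he ↦ hb.2 ?_
      rintro _ ⟨k, rfl⟩
      exact (hmono.monotone (by omega)).trans (he ⟨k, rfl⟩)

/-- The point `0` is vacuously closed under `g`; it is excluded so that unions indexed by `Iio a`
are over a nonempty set. -/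
theorem isClub_closurePoints (g : Omega1.{u} → Omega1.{u}) :
    IsClub {a : Omega1.{u} | (a.1 ≠ 0) ∧ ∀ b < a, g b < a} := by
  have h0 : IsClub {a : Omega1.{u} | ∀ b < a, a ∈ Ioi (g b)} :=
    isClub_diagonal fun a ↦ isClub_Ioi (g a)
  convert h0.inter cof_omega1_ne (isClub_Ioi (⟨0, Ordinal.omega_pos 1⟩ : Omega1.{u})) using 1
  ext a
  have : (⟨0, Ordinal.omega_pos 1⟩ : Omega1.{u}) < a ↔ a.1 ≠ 0 := by
    rw [← Subtype.coe_lt_coe]; exact pos_iff_ne_zero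
  simp only [mem_ofPred_eq, mem_inter_iff, mem_Ioi, this]
  exact and_comm

theorem isStationary_inter_isClub {E D : Set Omega1.{u}} (hE : IsStationary E) (hD : IsClub D) :
    IsStationary (E ∩ D) := fun T hT ↦ by
  rw [inter_assoc]; exact hE (hD.inter cof_omega1_ne hT)

/-! ### Clubs in `[X]^ω` -/

variable {X : Set Ordinal.{u}} {κ : Cardinal.{u}} {S : Set (Set Ordinal.{u})}

theorem iUnion_mem_countableSubsets {ι : Type*} [Countable ι] {f : ι → Set Ordinal.{u}}
    (hf : ∀ i, f i ∈ countableSubsets X) : (⋃ i, f i) ∈ countableSubsets X :=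
  ⟨iUnion_subset fun i ↦ (hf i).1, countable_iUnion fun i ↦ (hf i).2⟩

theorem union_mem_countableSubsets {x y : Set Ordinal.{u}} (hx : x ∈ countableSubsets X)
    (hy : y ∈ countableSubsets X) : x ∪ y ∈ countableSubsets X :=
  ⟨union_subset hx.1 hy.1, hx.2.union hy.2⟩

theorem IsClubIn.directed_iUnion_mem {C : Set (Set Ordinal.{u})} (hC : IsClubIn X C)
    {ι : Type*} [Countable ι] [Nonempty ι] {f : ι → Set Ordinal.{u}} (hf : ∀ i, f i ∈ C)
    (hdir : Directed (· ≤ ·) f) : (⋃ i, f i) ∈ C := by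
  have := Encodable.ofCountable ι
  inhabit ι
  have h := hC.closed _ hdir.sequence_mono fun n ↦ hf _
  convert h using 1
  exact Subset.antisymm
    (iUnion_subset fun i ↦ (hdir.le_sequence i).trans
      (subset_iUnion (fun n ↦ (f ∘ hdir.sequence f) n) _))
    (iUnion_subset fun n ↦ subset_iUnion f _)

theorem isClubIn_superset {p : Set Ordinal.{u}} (hp : p ∈ countableSubsets X) :
    IsClubIn X {x ∈ countableSubsets X | p ⊆ x} where
  subset _ hx := hx.1
  closed f _ hfC := ⟨iUnion_mem_countableSubsets fun n ↦ (hfC n).1,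
    (hfC 0).2.trans (subset_iUnion f 0)⟩
  cofinal x hx := ⟨x ∪ p, ⟨union_mem_countableSubsets hx hp, subset_union_right⟩,
    subset_union_left⟩

/-- A diagonal intersection: the clubs `C i` that `x` has to belong to are those with `i ∈ a x`. -/
theorem isClubIn_diagonal {ι : Type*} {C : ι → Set (Set Ordinal.{u})}
    (hC : ∀ i, IsClubIn X (C i)) (a : Set Ordinal.{u} → Set ι) (hmono : Monotone a)
    (hcont : ∀ f : ℕ → Set Ordinal.{u}, Monotone f → a (⋃ n, f n) ⊆ ⋃ n, a (f n))
    (hcount : ∀ x, x.Countable → (a x).Countable) :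
    IsClubIn X {x ∈ countableSubsets X | ∀ i ∈ a x, x ∈ C i} where
  subset _ hx := hx.1
  closed f hf hfC := by
    refine ⟨iUnion_mem_countableSubsets fun n ↦ (hfC n).1, fun i hi ↦ ?_⟩
    obtain ⟨m, hm⟩ := mem_iUnion.1 (hcont f hf hi)
    rw [← hf.iUnion_nat_add m]
    exact (hC i).closed _ (fun _ _ h ↦ hf (by omega))
      fun n ↦ (hfC _).2 i (hmono (hf (Nat.le_add_left _ _)) hm)
  cofinal x hx := by
    have hcof : ∀ i x, ∃ y, x ∈ countableSubsets X → y ∈ C i ∧ x ⊆ y := fun i x ↦ by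
      by_cases hx : x ∈ countableSubsets X
      · obtain ⟨y, hy⟩ := (hC i).cofinal x hx
        exact ⟨y, fun _ ↦ hy⟩
      · exact ⟨x, fun h ↦ absurd h hx⟩
    choose h hh using hcof
    let H : Set Ordinal.{u} → Set Ordinal.{u} := fun x ↦ x ∪ ⋃ i ∈ a x, h i x
    have hHX : ∀ x ∈ countableSubsets X, H x ∈ countableSubsets X := fun x hx ↦
      union_mem_countableSubsets hx
        ⟨iUnion₂_subset fun i _ ↦ ((hC i).subset (hh i x hx).1).1,
          (hcount x hx.2).biUnion fun i _ ↦ ((hC i).subset (hh i x hx).1).2⟩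
    let s : ℕ → Set Ordinal.{u} := fun n ↦ H^[n] x
    have hs : ∀ n, s (n + 1) = H (s n) := fun n ↦ Function.iterate_succ_apply' _ _ _
    have hsX : ∀ n, s n ∈ countableSubsets X := fun n ↦ by
      induction n with
      | zero => exact hx
      | succ n ih => rw [hs]; exact hHX _ ih
    have hsm : Monotone s := monotone_nat_of_le_succ fun n ↦ by
      rw [hs]; exact subset_union_left
    refine ⟨⋃ n, s n, ⟨iUnion_mem_countableSubsets hsX, fun i hi ↦ ?_⟩, subset_iUnion s 0⟩
    obtain ⟨m, hm⟩ := mem_iUnion.1 (hcont s hsm hi)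
    -- From stage `m` on, `s n ⊆ h i (s n) ⊆ s (n + 1)`, so the union of the `s n` is also the union
    -- of an increasing sequence from `C i`.
    have hle : ∀ n, s n ⊆ h i (s n) := fun n ↦ (hh i _ (hsX n)).2
    have hge : ∀ n, h i (s (n + m)) ⊆ s (n + m + 1) := fun n ↦ by
      rw [hs]
      exact subset_union_of_subset_right (subset_biUnion_of_mem (u := fun i ↦ h i (s (n + m)))
        (hmono (hsm (Nat.le_add_left _ _)) hm)) _
    have heq : ⋃ n, s n = ⋃ n, h i (s (n + m)) := by
      rw [← hsm.iUnion_nat_add m]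
      exact Subset.antisymm (iUnion_mono fun n ↦ hle _)
        (iUnion_subset fun n ↦ (hge n).trans (by
          rw [add_right_comm]; exact subset_iUnion (fun n ↦ s (n + m)) (n + 1)))
    rw [heq]
    exact (hC i).closed _ (monotone_nat_of_le_succ fun n ↦ (hge n).trans (by
      rw [add_right_comm]; exact hle _)) fun n ↦ (hh i _ (hsX _)).1

theorem IsClubIn.inter {C D : Set (Set Ordinal.{u})} (hC : IsClubIn X C) (hD : IsClubIn X D) :
    IsClubIn X (C ∩ D) := by
  have h := isClubIn_diagonal (C := fun b : Bool ↦ if b then C else D)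
    (by rintro (_ | _) <;> simpa) (fun _ ↦ univ) (fun _ _ _ ↦ le_rfl)
    (fun f _ ↦ by simp [iUnion_const]) (fun _ _ ↦ countable_univ)
  convert h using 1
  ext x
  simp only [mem_univ, true_implies, Bool.forall_bool]
  exact ⟨fun hx ↦ ⟨hC.subset hx.1, by simpa using hx.2, by simpa using hx.1⟩,
    fun hx ↦ ⟨by simpa using hx.2.2, by simpa using hx.2.1⟩⟩

/-- The countable sets that contain `0` and are closed under a function with countable values. -/
theorem isClubIn_closedUnder (h0 : (0 : Ordinal.{u}) ∈ X) {f : Ordinal.{u} → Set Ordinal.{u}}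
    (hf : ∀ i, f i ∈ countableSubsets X) :
    IsClubIn X {x ∈ countableSubsets X | 0 ∈ x ∧ ∀ i ∈ x, f i ⊆ x} := by
  have h := (isClubIn_superset (X := X) (p := {0})
    ⟨by simpa using h0, countable_singleton 0⟩).inter
    (isClubIn_diagonal (fun i ↦ isClubIn_superset (hf i)) id (fun _ _ h ↦ h)
      (fun f _ ↦ le_rfl) (fun _ h ↦ h))
  convert h using 1
  ext x
  constructor
  · rintro ⟨hx, hx0, hxf⟩
    exact ⟨⟨hx, by simpa using hx0⟩, hx, fun i hi ↦ ⟨hx, hxf i hi⟩⟩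
  · rintro ⟨⟨hx, hx0⟩, -, hxf⟩
    exact ⟨hx, by simpa using hx0, fun i hi ↦ (hxf i hi).2⟩


/-! ### The ordinal `δ_x` -/

theorem HasDelta.unique {x : Set Ordinal.{u}} {δ δ' : Omega1.{u}} (h : HasDelta x δ)
    (h' : HasDelta x δ') : δ = δ' :=
  Subtype.ext (Iio_injective (h.symm.trans h'))

theorem HasDelta.mem_iff {x : Set Ordinal.{u}} {δ : Omega1.{u}} (h : HasDelta x δ)
    (a : Omega1.{u}) : a.1 ∈ x ↔ a < δ := by
  have := Set.ext_iff.1 h a.1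
  simp only [mem_inter_iff, mem_Iio, Subtype.coe_lt_coe] at this
  exact ⟨fun ha ↦ this.1 ⟨ha, a.2⟩, fun ha ↦ (this.2 ha).1⟩

theorem hasDelta_of_forall_mem_iff {x : Set Ordinal.{u}} {δ : Omega1.{u}}
    (h : ∀ a : Omega1.{u}, a.1 ∈ x ↔ a < δ) : HasDelta x δ := by
  ext i
  exact ⟨fun hi ↦ (h ⟨i, hi.2⟩).1 hi.1,
    fun hi ↦ ⟨(h ⟨i, mem_Iio.2 (lt_trans hi δ.2)⟩).2 hi, mem_Iio.2 (lt_trans hi δ.2)⟩⟩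

theorem exists_omega1_bound {x : Set Ordinal.{u}} (hx : x.Countable) :
    ∃ a : Omega1.{u}, ∀ b : Omega1.{u}, b.1 ∈ x → b < a :=
  exists_lt_of_countable (hx.preimage Subtype.val_injective)

theorem Iio_omega1_subset_base (hκ : ℵ₁ < κ) : Iio ω₁ ⊆ base κ := by
  have : (ω₁ : Ordinal.{u}) ≤ κ.ord := by
    rw [← ord_aleph]; exact ord_le_ord.2 hκ.le
  exact Iio_subset_Iio this

/-- Members of `C` are chosen by recursion at limits too, so the chain need not be continuous;
`IsClubIn.exists_hasDelta` takes the unions it needs. -/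
theorem IsClubIn.exists_increasing {C : Set (Set Ordinal.{u})} (hC : IsClubIn X C)
    (hX : Iio ω₁ ⊆ X) {ξ : Ordinal.{u}} (hξ : ξ ∈ X) :
    ∃ N : Omega1.{u} → Set Ordinal.{u}, Monotone N ∧ ∀ a, N a ∈ C ∧ ξ ∈ N a ∧ a.1 ∈ N a := by
  have hcof : ∀ x, ∃ y, x ∈ countableSubsets X → y ∈ C ∧ x ⊆ y := fun x ↦ by
    by_cases hx : x ∈ countableSubsets X
    · obtain ⟨y, hy⟩ := hC.cofinal x hx
      exact ⟨y, fun _ ↦ hy⟩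
    · exact ⟨x, fun h ↦ absurd h hx⟩
  choose h hh using hcof
  let F : (a : Omega1.{u}) → ((b : Omega1.{u}) → b < a → Set Ordinal.{u}) → Set Ordinal.{u} :=
    fun a N ↦ {ξ, a.1} ∪ ⋃ b : Iio a, N b b.2
  let N : Omega1.{u} → Set Ordinal.{u} := wellFounded_lt.fix fun a N ↦ h (F a N)
  have hN : ∀ a, N a = h (F a fun b _ ↦ N b) := fun a ↦ wellFounded_lt.fix_eq _ a
  have key : ∀ a, F a (fun b _ ↦ N b) ∈ countableSubsets X ∧ N a ∈ C := by
    intro a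
    induction a using WellFoundedLT.induction with
    | ind a ih =>
      have hF : F a (fun b _ ↦ N b) ∈ countableSubsets X := by
        have := (omega1_countable_Iio a).to_subtype
        refine union_mem_countableSubsets ⟨?_, by simp⟩
          (iUnion_mem_countableSubsets fun b ↦ hC.subset (ih b b.2).2)
        rintro _ (rfl | rfl)
        exacts [hξ, hX a.2]
      exact ⟨hF, by rw [hN]; exact (hh _ hF).1⟩
  have hle : ∀ a, F a (fun b _ ↦ N b) ⊆ N a := fun a ↦ by
    conv_rhs => rw [hN]
    exact (hh _ (key a).1).2
  refine ⟨N, fun a b hab ↦ ?_, fun a ↦ ⟨(key a).2, hle a (Or.inl (by simp)),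
    hle a (Or.inl (by simp))⟩⟩
  obtain rfl | hab := hab.eq_or_lt
  · rfl
  · exact (subset_iUnion (fun c : Iio b ↦ N c) ⟨a, hab⟩).trans (subset_union_right.trans (hle b))

/-- The set of `x` with `δ_x` in a given stationary set, and containing a given point, is
stationary. -/
theorem IsClubIn.exists_hasDelta {C : Set (Set Ordinal.{u})} (hC : IsClubIn X C)
    (hX : Iio ω₁ ⊆ X) {ξ : Ordinal.{u}} (hξ : ξ ∈ X) {E : Set Omega1.{u}} (hE : IsStationary E) :
    ∃ x ∈ C, ξ ∈ x ∧ ∃ δ ∈ E, HasDelta x δ := by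
  obtain ⟨N, hmono, hN⟩ := hC.exists_increasing hX hξ
  choose g hg using fun a ↦ exists_omega1_bound (hC.subset (hN a).1).2
  -- At a closure point of the bounds `g`, the union of the earlier sets contains exactly the
  -- countable ordinals below `a`.
  obtain ⟨a, haE, ha0, ha⟩ := hE (isClub_closurePoints g)
  have := (omega1_countable_Iio a).to_subtype
  let o : Iio a := ⟨⟨0, Ordinal.omega_pos 1⟩, mem_Iio.2 (Subtype.coe_lt_coe.1 (pos_iff_ne_zero.2 ha0))⟩
  have : Nonempty (Iio a) := ⟨o⟩
  refine ⟨⋃ b : Iio a, N b, hC.directed_iUnion_mem (fun b ↦ (hN b).1)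
    (Monotone.directed_le fun b c h ↦ hmono h), mem_iUnion.2 ⟨o, (hN _).2.1⟩, a, haE,
    hasDelta_of_forall_mem_iff fun b ↦ ⟨fun hb ↦ ?_, fun hb ↦ mem_iUnion.2 ⟨⟨b, hb⟩, (hN b).2.2⟩⟩⟩
  obtain ⟨c, hc⟩ := mem_iUnion.1 hb
  exact (hg c b hc).trans (ha c c.2)

/-- If `x` contains `0` and is closed under `i ↦ Iic (next i)`, then `x ∩ ω₁` is an initial segment
without maximum in which `D` is cofinal, so its supremum `δ_x` lies in `D`. Taking `D = univ` shows
that `δ_x` is defined on a club. -/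
theorem exists_isClubIn_hasDelta (hX : Iio ω₁ ⊆ X) {D : Set Omega1.{u}} (hD : IsClub D) :
    ∃ C, IsClubIn X C ∧ ∀ x ∈ C, ∃ δ ∈ D, HasDelta x δ := by
  have hnext : ∀ a : Omega1.{u}, ∃ b ∈ D, a < b := fun a ↦ by
    obtain ⟨c, hc⟩ := exists_gt a
    obtain ⟨b, hb, hcb⟩ := hD.isCofinal c
    exact ⟨b, hb, hc.trans_le hcb⟩
  choose next hnextD hnext using hnext
  let f : Ordinal.{u} → Set Ordinal.{u} := fun i ↦
    if hi : i < ω₁ then Iic (next ⟨i, hi⟩).1 else ∅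
  have hf : ∀ i, f i ∈ countableSubsets X := fun i ↦ by
    by_cases hi : i < ω₁
    · simp only [f, hi, dif_pos]
      refine ⟨fun j hj ↦ hX (mem_Iio.2 (lt_of_le_of_lt hj (next ⟨i, hi⟩).2)), ?_⟩
      rw [← Iio_union_right]
      exact (countable_Iio_of_lt (next ⟨i, hi⟩).2).union (countable_singleton _)
    · simp only [f, hi, dif_neg, not_false_eq_true]
      exact ⟨empty_subset _, countable_empty⟩
  refine ⟨_, isClubIn_closedUnder (hX (Ordinal.omega_pos 1)) hf, fun x ⟨hx, hx0, hxf⟩ ↦ ?_⟩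
  have hxf' : ∀ a b : Omega1.{u}, a.1 ∈ x → b ≤ next a → b.1 ∈ x := fun a b ha hb ↦ by
    refine hxf a ha ?_
    have : a.1 < ω₁ := a.2
    simp only [f, this, dif_pos]
    exact hb
  let t : Set Omega1.{u} := Subtype.val ⁻¹' x
  obtain ⟨δ, hδ⟩ := exists_isLUB_of_countable (s := t) (hx.2.preimage Subtype.val_injective)
  have hlt : ∀ a : Omega1.{u}, a.1 ∈ x ↔ a < δ := fun a ↦ by
    refine ⟨fun ha ↦ (hnext a).trans_le (hδ.1 (hxf' a _ ha le_rfl)), fun ha ↦ ?_⟩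
    obtain ⟨b, hb, hab⟩ := (lt_isLUB_iff hδ).1 ha
    exact hxf' b a hb (hab.trans (hnext b)).le
  have hLUB : IsLUB (next '' t) δ := by
    refine ⟨?_, fun e he ↦ hδ.2 fun a ha ↦ (hnext a).le.trans (he ⟨a, ha, rfl⟩)⟩
    rintro _ ⟨a, ha, rfl⟩
    exact hδ.1 (hxf' a _ ha le_rfl)
  have hne : t.Nonempty := ⟨⟨0, Ordinal.omega_pos 1⟩, hx0⟩
  refine ⟨δ, hD.isLUB_mem ?_ (hne.image next) hLUB, hasDelta_of_forall_mem_iff hlt⟩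
  rintro _ ⟨a, -, rfl⟩
  exact hnextD a

/-! ### The normal ideal on `ω₁` induced by `S` -/

theorem above_subset (hS : S ⊆ countableSubsets X) (A : Set Omega1.{u}) :
    above S A ⊆ countableSubsets X := fun _ hx ↦ hS hx.1

theorem not_isStationaryIn_above_iff (hS : S ⊆ countableSubsets X) {B : Set Omega1.{u}} :
    ¬ IsStationaryIn X (above S B) ↔
      ∃ C, IsClubIn X C ∧ ∀ x ∈ C, x ∈ S → ∀ δ ∈ B, ¬ HasDelta x δ := by
  simp only [IsStationaryIn, above_subset hS, true_and, not_forall, not_nonempty_iff_eq_empty,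
    exists_prop]
  refine exists_congr fun C ↦ and_congr_right fun _ ↦ ?_
  rw [eq_empty_iff_forall_notMem]
  exact ⟨fun h x hxC hxS δ hδ hd ↦ h x ⟨⟨hxS, δ, hδ, hd⟩, hxC⟩,
    fun h x hx ↦ by obtain ⟨⟨hxS, δ, hδ, hd⟩, hxC⟩ := hx; exact h x hxC hxS δ hδ hd⟩

theorem not_isStationaryIn_above_of_not_isStationary (hX : Iio ω₁ ⊆ X)
    (hS : S ⊆ countableSubsets X) {B : Set Omega1.{u}} (hB : ¬ IsStationary B) :
    ¬ IsStationaryIn X (above S B) := by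
  obtain ⟨D, hD, hBD⟩ := not_isStationary_iff.1 hB
  obtain ⟨C, hC, hCD⟩ := exists_isClubIn_hasDelta hX hD
  refine (not_isStationaryIn_above_iff hS).2 ⟨C, hC, fun x hx _ δ hδ hd ↦ ?_⟩
  obtain ⟨δ', hδ', hd'⟩ := hCD x hx
  exact disjoint_left.1 hBD hδ (hd.unique hd' ▸ hδ')

theorem not_isStationaryIn_above_union (hS : S ⊆ countableSubsets X) {A B : Set Omega1.{u}}
    (hA : ¬ IsStationaryIn X (above S A)) (hB : ¬ IsStationaryIn X (above S B)) :
    ¬ IsStationaryIn X (above S (A ∪ B)) := by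
  rw [not_isStationaryIn_above_iff hS] at *
  obtain ⟨C, hC, hCA⟩ := hA
  obtain ⟨D, hD, hDB⟩ := hB
  refine ⟨C ∩ D, hC.inter hD, fun x hx hxS δ hδ ↦ ?_⟩
  exact hδ.elim (hCA x hx.1 hxS δ) (hDB x hx.2 hxS δ)

/-- The ideal of all `B ⊆ ω₁` with `{x ∈ S | δ_x ∈ B}` nonstationary is normal. -/
theorem not_isStationaryIn_above_diagonal (hS : S ⊆ countableSubsets X)
    {B : Omega1.{u} → Set Omega1.{u}} (hB : ∀ a, ¬ IsStationaryIn X (above S (B a))) :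
    ¬ IsStationaryIn X (above S {a | ∃ b < a, a ∈ B b}) := by
  simp only [not_isStationaryIn_above_iff hS] at *
  choose C hC hCB using hB
  -- The diagonal intersection is indexed by `x ∩ ω₁`, which is exactly the set of `b < δ_x`.
  refine ⟨_, isClubIn_diagonal hC (fun x ↦ Subtype.val ⁻¹' x) (fun _ _ h ↦ preimage_mono h)
    (fun f _ ↦ by rw [preimage_iUnion]) (fun x hx ↦ hx.preimage Subtype.val_injective), ?_⟩
  rintro x ⟨-, hx⟩ hxS δ ⟨b, hbδ, hδ⟩ hd
  exact hCB b x (hx b ((hd.mem_iff b).2 hbδ)) hxS δ hδ hd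

/-- Otherwise all of `ω₁` would be in the ideal; since `δ_x` is defined on a club, `S` itself would
be nonstationary. -/
theorem isStationary_of_above_compl {A : Set Omega1.{u}} (hX : Iio ω₁ ⊆ X)
    (hS : IsStationaryIn X S) (hA : ¬ IsStationaryIn X (above S Aᶜ)) : IsStationary A := by
  by_contra h
  have := not_isStationaryIn_above_union hS.1
    (not_isStationaryIn_above_of_not_isStationary hX hS.1 h) hA
  rw [union_compl_self, not_isStationaryIn_above_iff hS.1] at this
  obtain ⟨C, hC, hCS⟩ := this
  obtain ⟨D, hD, hDδ⟩ := exists_isClubIn_hasDelta hX IsClub.univ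
  obtain ⟨x, hxS, hxC, hxD⟩ := hS.2 _ (hC.inter hD)
  obtain ⟨δ, hδ, hd⟩ := hDδ x hxD
  exact hCS x hxC hxS δ hδ hd


/-! ### Limit points and `ω₁`-chains -/

theorem isSuccLimit_of_closed {g : Omega1.{u} → Omega1.{u}} (hg : ∀ a, a < g a) {a : Omega1.{u}}
    (ha0 : a.1 ≠ 0) (ha : ∀ b < a, g b < a) : IsSuccLimit a := by
  refine ⟨fun hmin ↦ ?_, fun b hb ↦ hb.2 (hg b) (ha b hb.1)⟩
  have : (⟨0, Ordinal.omega_pos 1⟩ : Omega1.{u}) < a :=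
    Subtype.coe_lt_coe.1 (pos_iff_ne_zero.2 ha0)
  exact this.not_ge (hmin this.le)

theorem isClub_limit_diagonal {C : Omega1.{u} → Set Omega1.{u}} (hC : ∀ a, IsClub (C a)) :
    ∃ D, IsClub D ∧ ∀ a ∈ D, IsSuccLimit a ∧ ∀ b < a, a ∈ C b := by
  choose g hg using fun a : Omega1.{u} ↦ exists_gt a
  exact ⟨_, (isClub_closurePoints g).inter cof_omega1_ne (isClub_diagonal hC),
    fun a ha ↦ ⟨isSuccLimit_of_closed hg ha.1.1 ha.1.2, ha.2⟩⟩

theorem mk_iUnion_le_aleph_one {N : Omega1.{u} → Set Ordinal.{u}} (hN : ∀ a, (N a).Countable) :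
    #(⋃ a, N a) ≤ ℵ₁ := by
  refine (mk_iUnion_le N).trans ?_
  rw [mk_omega1]
  calc ℵ₁ * ⨆ a, #(N a) ≤ ℵ₁ * ℵ₀ := by
        gcongr
        exact ciSup_le' fun a ↦ le_aleph0_iff_set_countable.2 (hN a)
    _ = ℵ₁ := mul_aleph0_eq (aleph0_le_aleph 1)

/-- Continuity of the chain makes `α ↦ δ_{N_α}` a normal function, and its fixed points form a club.
-/
theorem IsOmega1Chain.exists_isClub_hasDelta {N : Omega1.{u} → Set Ordinal.{u}}
    (hN : IsOmega1Chain X N) : ∃ D, IsClub D ∧ ∀ a ∈ D, HasDelta (N a) a := by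
  obtain ⟨d, hd, hNd⟩ := hN.delta_lt
  have hnormal : IsNormal d := isNormal_iff.2 ⟨hd, fun a ha e he ↦ le_of_forall_lt fun c hc ↦ by
    have hcN := ((hNd a).mem_iff c).2 hc
    rw [hN.continuous a ha] at hcN
    obtain ⟨b, hb, hcb⟩ := mem_iUnion₂.1 hcN
    exact (((hNd b).mem_iff c).1 hcb).trans_le (he b hb)⟩
  refine ⟨_, hnormal.isClub_fixedPoints cof_omega1_ne, fun a ha ↦ ?_⟩
  have := hNd a
  rwa [show d a = a from ha] at this

/-! ### Saturation of the nonstationary ideal -/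

/-- Every antichain of sets in `P` modulo the nonstationary ideal extends to a maximal one. -/
theorem exists_maximal_antichain (P : Set Omega1.{u} → Prop) {W₀ : Set (Set Omega1.{u})}
    (hW₀ : ∀ B ∈ W₀, P B) (hanti : W₀.Pairwise fun A B ↦ ¬ IsStationary (A ∩ B)) :
    ∃ W, W₀ ⊆ W ∧ (∀ B ∈ W, P B) ∧ (W.Pairwise fun A B ↦ ¬ IsStationary (A ∩ B)) ∧
      ∀ E, P E → IsStationary E → ∃ B ∈ W, IsStationary (E ∩ B) := by
  obtain ⟨W, hW₀W, hmax⟩ := zorn_subset_nonempty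
    {W | (∀ B ∈ W, P B) ∧ W.Pairwise fun A B ↦ ¬ IsStationary (A ∩ B)}
    (fun c hc hchain _ ↦ ⟨⋃₀ c, ⟨fun B ⟨w, hw, hB⟩ ↦ (hc hw).1 B hB,
      (pairwise_sUnion hchain.directedOn).2 fun w hw ↦ (hc hw).2⟩,
      fun w hw ↦ subset_sUnion_of_mem hw⟩) W₀ ⟨hW₀, hanti⟩
  refine ⟨W, hW₀W, hmax.prop.1, hmax.prop.2, fun E hPE hE ↦ ?_⟩
  by_contra! hcon
  have hins : insert E W ⊆ W := hmax.2 ⟨?_, ?_⟩ (subset_insert E W)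
  · exact hcon E (hins (mem_insert E W)) (by rwa [inter_self])
  · rintro B (rfl | hB)
    exacts [hPE, hmax.prop.1 B hB]
  · refine hmax.prop.2.insert fun B hB _ ↦ ⟨hcon B hB, ?_⟩
    rw [inter_comm]
    exact hcon B hB

/-- Subsets of `ω₁` get ordinal names below `κ`, so that countable subsets of `κ` can refer to
members of an antichain. -/
theorem exists_coding : ∃ κ : Cardinal.{u}, ℵ₁ < κ ∧
    ∃ f : Ordinal.{u} → Set Omega1.{u}, ∀ B, ∃ ξ ∈ base κ, f ξ = B := by
  refine ⟨2 ^ (ℵ₁ : Cardinal.{u}), cantor _, ?_⟩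
  have : #(base (2 ^ (ℵ₁ : Cardinal.{u}))) = #(Set Omega1.{u}) := by
    rw [mk_set, mk_omega1, Cardinal.mk_Iio_ordinal, card_ord]
    simp
  obtain ⟨e⟩ := Cardinal.eq.1 this
  refine ⟨Function.extend Subtype.val e fun _ ↦ ∅, fun B ↦ ⟨e.symm B, (e.symm B).2, ?_⟩⟩
  rw [Subtype.val_injective.extend_apply, e.apply_symm_apply]

/-- Under `SRP` the nonstationary ideal on `ω₁` is saturated. -/
theorem SRP.exists_enumeration (hSRP : SRP.{u}) {W₀ : Set (Set Omega1.{u})}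
    (hW₀ : ∀ B ∈ W₀, IsStationary B) (hanti₀ : W₀.Pairwise fun A B ↦ ¬ IsStationary (A ∩ B)) :
    ∃ B : Omega1.{u} → Set Omega1.{u}, W₀ ⊆ range B := by
  obtain ⟨W, hW₀W, hW, hanti, hmax⟩ := exists_maximal_antichain IsStationary hW₀ hanti₀
  obtain ⟨κ, hκ, f, hf⟩ := exists_coding.{u}
  have hX := Iio_omega1_subset_base hκ
  -- SRP is applied to the `x` such that `δ_x` lies in a member of `W` named in `x`; maximality of
  -- `W` makes this set projective stationary.
  obtain ⟨N, hN, hNS⟩ := hSRP κ hκ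
    {x ∈ countableSubsets (base κ) | ∃ ξ ∈ x, f ξ ∈ W ∧ ∃ δ ∈ f ξ, HasDelta x δ} <| by
    refine ⟨fun x hx ↦ hx.1, fun E hE ↦ ⟨above_subset (fun x hx ↦ hx.1) E, fun C hC ↦ ?_⟩⟩
    obtain ⟨B, hBW, hEB⟩ := hmax E hE hE
    obtain ⟨ξ, hξ, rfl⟩ := hf B
    obtain ⟨x, hxC, hξx, δ, hδ, hd⟩ := hC.exists_hasDelta hX hξ hEB
    exact ⟨x, ⟨⟨hC.subset hxC, ξ, hξx, hBW, δ, hδ.2, hd⟩, δ, hδ.1, hd⟩, hxC⟩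
  -- If `B` is not named in the chain, it is almost disjoint from every named member. At a limit `a
  -- ∈ B` in the diagonal intersection of the witnessing clubs with `δ_{N a} = a`, the name that
  -- puts `a` in a member of `W` already occurs in some `N b` with `b < a`, a contradiction.
  have hWN : ∀ B ∈ W, ∃ ξ ∈ ⋃ a, N a, f ξ = B := by
    intro B hB
    by_contra! hcon
    have hclub : ∀ ξ ∈ ⋃ a, N a, ∃ C, IsClub C ∧ (f ξ ∈ W → Disjoint (B ∩ f ξ) C) := by
      intro ξ hξ
      by_cases hfW : f ξ ∈ W
      · obtain ⟨C, hC, hdis⟩ := not_isStationary_iff.1 (hanti hB hfW (hcon ξ hξ).symm)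
        exact ⟨C, hC, fun _ ↦ hdis⟩
      · exact ⟨univ, .univ, fun h ↦ absurd h hfW⟩
    choose! C hC hCdis using hclub
    obtain ⟨D, hD, hDlim⟩ := isClub_limit_diagonal (C := fun a ↦ ⋂ ξ : N a, C ξ) fun a ↦ by
      have := (hN.mem a).2.to_subtype
      exact IsClub.iInter_of_countable cof_omega1_ne fun ξ ↦ hC ξ (mem_iUnion.2 ⟨a, ξ.2⟩)
    obtain ⟨F, hF, hFδ⟩ := hN.exists_isClub_hasDelta
    obtain ⟨a, haB, haD, haF⟩ := hW B hB (hD.inter cof_omega1_ne hF)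
    obtain ⟨-, ξ, hξ, hfW, δ, hδ, hd⟩ := hNS a
    obtain rfl := (hFδ a haF).unique hd
    obtain ⟨hlim, hdiag⟩ := hDlim a haD
    rw [hN.continuous a hlim] at hξ
    obtain ⟨b, hb, hξb⟩ := mem_iUnion₂.1 hξ
    exact disjoint_left.1 (hCdis ξ (mem_iUnion.2 ⟨b, hξb⟩) hfW) ⟨haB, hδ⟩
      (mem_iInter.1 (hdiag b hb) ⟨ξ, hξb⟩)
  have hcard : #(⋃ a, N a) ≤ #Omega1.{u} :=
    (mk_iUnion_le_aleph_one fun a ↦ (hN.mem a).2).trans mk_omega1.ge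
  obtain ⟨e⟩ := (Cardinal.le_def _ _).1 hcard
  refine ⟨Function.extend e (fun ξ ↦ f ξ) fun _ ↦ ∅, fun B hB ↦ ?_⟩
  obtain ⟨ξ, hξ, rfl⟩ := hWN B (hW₀W hB)
  exact ⟨e ⟨ξ, hξ⟩, by rw [e.injective.extend_apply]⟩

/-! ### Existence of traces -/

theorem SRP.exists_isTrace (hSRP : SRP.{u}) (hκ : ℵ₁ < κ) (hS : IsStationaryIn (base κ) S) :
    ∃ A, IsTrace κ S A := by
  have hX := Iio_omega1_subset_base hκ
  obtain ⟨W, -, hW, hanti, hmax⟩ := exists_maximal_antichain (W₀ := ∅)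
    (fun B : Set Omega1.{u} ↦ IsStationary B ∧ ¬ IsStationaryIn (base κ) (above S B))
    (by simp) (by simp)
  obtain ⟨B, hB⟩ := hSRP.exists_enumeration (fun B hB ↦ (hW B hB).1) hanti
  -- The enumeration may take values outside `W`; these are replaced by `∅` so that every term is in
  -- the ideal.
  let B' : Omega1.{u} → Set Omega1.{u} := fun a ↦ {δ ∈ B a | B a ∈ W}
  have hB' : ∀ a, ¬ IsStationaryIn (base κ) (above S (B' a)) := by
    intro a
    by_cases ha : B a ∈ W
    · simpa [B', ha] using (hW _ ha).2
    · refine not_isStationaryIn_above_of_not_isStationary hX hS.1 ?_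
      simp [B', ha]
  have hU := not_isStationaryIn_above_diagonal hS.1 hB'
  set U := {a | ∃ b < a, a ∈ B' b}
  refine ⟨Uᶜ, isStationary_of_above_compl hX hS (by rwa [compl_compl]),
    ⟨hS.1, fun E hE hEU ↦ ?_⟩, by rwa [compl_compl]⟩
  by_contra hcon
  obtain ⟨_, hBW, hEB⟩ := hmax E ⟨hE, hcon⟩ hE
  obtain ⟨a, rfl⟩ := hB hBW
  -- A stationary subset of `B a` has points above its index `a`, and such points belong to the
  -- diagonal union `U`.
  obtain ⟨b, hb, hab⟩ := hEB (isClub_Ioi a)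
  exact hEU hb.1 ⟨a, hab, hb.2, hBW⟩

/-- This absorbs the club `D` into the trace, so that the first assertion follows from the second.
-/
theorem IsTrace.inter_isClub {A D : Set Omega1.{u}} (hκ : ℵ₁ < κ)
    (hA : IsTrace κ S A) (hD : IsClub D) : IsTrace κ S (A ∩ D) where
  stationary := isStationary_inter_isClub hA.stationary hD
  projective := ⟨hA.projective.1,
    fun B hB hBA ↦ hA.projective.2 B hB (hBA.trans inter_subset_left)⟩
  nonstationary := by
    rw [compl_inter]
    refine not_isStationaryIn_above_union hA.projective.1 hA.nonstationary
      (not_isStationaryIn_above_of_not_isStationary (Iio_omega1_subset_base hκ)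
        hA.projective.1 ?_)
    exact not_isStationary_iff.2 ⟨D, hD, disjoint_compl_left⟩

/-! ### Chains through a trace, and reflection -/

/-- Replacing the countable ordinals in the `a`-th member of an `ω₁`-chain by those below `a`. -/
theorem IsOmega1Chain.normalize (hX : Iio ω₁ ⊆ X) {N : Omega1.{u} → Set Ordinal.{u}}
    (hN : IsOmega1Chain X N) :
    IsOmega1Chain X (fun a ↦ (N a \ Iio ω₁) ∪ Iio a.1) ∧
      ∀ a : Omega1.{u}, HasDelta ((N a \ Iio ω₁) ∪ Iio a.1) a := by
  have hδ : ∀ a : Omega1.{u}, HasDelta ((N a \ Iio ω₁) ∪ Iio a.1) a := fun a ↦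
    hasDelta_of_forall_mem_iff fun b ↦
      ⟨fun hb ↦ hb.elim (fun h ↦ absurd b.2 h.2) id, fun hb ↦ Or.inr hb⟩
  refine ⟨⟨fun a ↦ union_mem_countableSubsets
    ⟨sdiff_subset.trans (hN.mem a).1, (hN.mem a).2.mono sdiff_subset⟩
    ⟨(Iio_subset_Iio a.2.le).trans hX, countable_Iio_of_lt a.2⟩,
    fun a b hab ↦ union_subset_union (sdiff_subset_sdiff_left (hN.mono hab)) (Iio_subset_Iio hab),
    fun a ha ↦ Subset.antisymm ?_ ?_, id, strictMono_id, hδ⟩, hδ⟩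
  · rintro i (⟨hi, hi'⟩ | hi)
    · rw [hN.continuous a ha] at hi
      obtain ⟨b, hb, hib⟩ := mem_iUnion₂.1 hi
      exact mem_iUnion₂.2 ⟨b, hb, Or.inl ⟨hib, hi'⟩⟩
    · obtain ⟨b, hb, hib⟩ := (ha.isSuccPrelimit.lt_iff_exists_lt
        (a := (⟨i, mem_Iio.2 (lt_trans hi a.2)⟩ : Omega1.{u}))).1 hi
      exact mem_iUnion₂.2 ⟨b, hb, Or.inr hib⟩
  · exact iUnion₂_subset fun b hb ↦ union_subset_union
      (sdiff_subset_sdiff_left (hN.mono (mem_Iio.1 hb).le)) (Iio_subset_Iio (mem_Iio.1 hb).le)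

theorem SRP.exists_isChainThrough (hSRP : SRP.{u}) (hκ : ℵ₁ < κ) {A : Set Omega1.{u}}
    (hA : IsTrace κ S A) : ∃ D, IsClub D ∧ ∃ X N, IsChainThrough κ S (A ∩ D) X N := by
  have hX := Iio_omega1_subset_base hκ
  have hS := hA.projective.1
  obtain ⟨N, hN, hNS⟩ := hSRP κ hκ
    (S ∪ {x ∈ countableSubsets (base κ) | ∃ δ ∈ Aᶜ, HasDelta x δ}) <| by
    have hsub : S ∪ {x ∈ countableSubsets (base κ) | ∃ δ ∈ Aᶜ, HasDelta x δ} ⊆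
      countableSubsets (base κ) := union_subset hS fun x hx ↦ hx.1
    refine ⟨hsub, fun E hE ↦ ⟨above_subset hsub E, fun C hC ↦ ?_⟩⟩
    -- One half of `E` is stationary: inside `A` the trace provides points of `S`, outside `A` every
    -- `x` with the right `δ_x` is allowed.
    rw [← inter_union_compl E A, isStationary_union_iff cof_omega1_ne] at hE
    obtain hE | hE := hE
    · obtain ⟨x, ⟨hxS, δ, hδ, hd⟩, hxC⟩ := (hA.projective.2 _ hE inter_subset_right).2 C hC
      exact ⟨x, ⟨Or.inl hxS, δ, hδ.1, hd⟩, hxC⟩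
    · obtain ⟨x, hxC, -, δ, hδ, hd⟩ := hC.exists_hasDelta hX (hX (mem_Iio.2 (Ordinal.omega_pos 1))) hE
      exact ⟨x, ⟨Or.inr ⟨hC.subset hxC, δ, hδ.2, hd⟩, δ, hδ.1, hd⟩, hxC⟩
  obtain ⟨D, hD, hDδ⟩ := hN.exists_isClub_hasDelta
  obtain ⟨hN', hδ⟩ := hN.normalize hX
  have homega : Iio ω₁ ⊆ ⋃ a : Omega1.{u}, ((N a \ Iio ω₁) ∪ Iio a.1) := fun i hi ↦ by
    obtain ⟨b, hb⟩ := exists_gt (⟨i, hi⟩ : Omega1.{u})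
    exact mem_iUnion.2 ⟨b, Or.inr hb⟩
  refine ⟨D, hD, _, _, ⟨le_antisymm (mk_iUnion_le_aleph_one fun a ↦ (hN'.mem a).2) ?_,
    homega, hN', hδ, rfl, fun a ha ↦ ?_⟩⟩
  · rw [← mk_omega1]
    exact mk_le_mk_of_subset homega
  · have hd := hDδ a ha.2
    -- On `D` the normalization changes nothing, so membership in `S` survives.
    have heq : (N a \ Iio ω₁) ∪ Iio a.1 = N a := by
      rw [← show N a ∩ Iio ω₁ = Iio a.1 from hd, sdiff_union_inter]
    simp only [heq]
    obtain h | ⟨-, δ, hδA, hd'⟩ := hNS a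
    · exact h
    · exact absurd (hd.unique hd' ▸ ha.1) hδA

/-- Interleave the chain with members `y a` of the club `C`: at closure points of the interleaving,
`N a` is a directed union of sets `y b` and hence in `C`. A stationary `A` contains such a point. -/
theorem IsChainThrough.isStationaryIn {A : Set Omega1.{u}} {N : Omega1.{u} → Set Ordinal.{u}}
    (h : IsChainThrough κ S A X N) (hA : IsStationary A) :
    IsStationaryIn X (S ∩ countableSubsets X) := by
  refine ⟨inter_subset_right, fun C hC ↦ ?_⟩
  have hNX : ∀ a, N a ∈ countableSubsets X := fun a ↦
    ⟨h.union ▸ subset_iUnion N a, (h.chain.mem a).2⟩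
  choose y hyC hNy using fun a ↦ hC.cofinal (N a) (hNX a)
  have hbound : ∀ a, ∃ b, a < b ∧ y a ⊆ N b := fun a ↦ by
    have hy := hC.subset (hyC a)
    have hmem : ∀ i : y a, ∃ b, i.1 ∈ N b := fun i ↦ by
      have := hy.1 i.2
      rw [h.union] at this
      exact mem_iUnion.1 this
    choose b hb using hmem
    have := hy.2.to_subtype
    obtain ⟨c, hc⟩ := exists_lt_of_countable ((countable_range b).insert a)
    exact ⟨c, hc a (mem_insert _ _), fun i hi ↦
      h.chain.mono (hc _ (mem_insert_of_mem _ ⟨⟨i, hi⟩, rfl⟩)).le (hb ⟨i, hi⟩)⟩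
  choose g hg hyg using hbound
  obtain ⟨a, haA, ha0, ha⟩ := hA (isClub_closurePoints g)
  have hlim := isSuccLimit_of_closed hg ha0 ha
  have heq : N a = ⋃ b : Iio a, y b := by
    rw [h.chain.continuous a hlim, biUnion_eq_iUnion]
    refine Subset.antisymm (iUnion_mono fun b ↦ hNy b) (iUnion_subset fun b ↦ ?_)
    exact (hyg b).trans (subset_iUnion (fun b : Iio a ↦ N b) ⟨g b, ha b b.2⟩)
  have := (omega1_countable_Iio a).to_subtype
  have : Nonempty (Iio a) :=
    ⟨⟨⟨0, Ordinal.omega_pos 1⟩, mem_Iio.2 (Subtype.coe_lt_coe.1 (pos_iff_ne_zero.2 ha0))⟩⟩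
  have hdir : Directed (· ≤ ·) fun b : Iio a ↦ y b := fun b c ↦ by
    refine ⟨⟨max (g b) (g c), max_lt (ha b b.2) (ha c c.2)⟩, ?_, ?_⟩
    · exact (hyg b).trans ((h.chain.mono (le_max_left _ _)).trans (hNy _))
    · exact (hyg c).trans ((h.chain.mono (le_max_right _ _)).trans (hNy _))
  exact ⟨N a, ⟨h.mem a haA, hNX a⟩, heq ▸ hC.directed_iUnion_mem (fun b ↦ hyC b) hdir⟩

end Reflection

theorem corollary6p4 (hSRP : Reflection.SRP.{u}) :
    Reflection.WRP.{u} ∧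
    ∀ κ : Cardinal.{u}, ℵ₁ < κ → ∀ S : Set (Set Ordinal.{u}),
      Reflection.IsStationaryIn (Reflection.base κ) S →
      (∃ A : Set Reflection.Omega1.{u}, Reflection.IsTrace κ S A ∧
        ∃ (X : Set Ordinal.{u}) (N : Reflection.Omega1.{u} → Set Ordinal.{u}),
          Reflection.IsChainThrough κ S A X N) ∧
      (∀ A : Set Reflection.Omega1.{u}, Reflection.IsTrace κ S A →
        ∃ D : Set Reflection.Omega1.{u}, IsClub D ∧
        ∃ (X : Set Ordinal.{u}) (N : Reflection.Omega1.{u} → Set Ordinal.{u}),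
          Reflection.IsChainThrough κ S (A ∩ D) X N) := by
  have key : ∀ κ : Cardinal.{u}, ℵ₁ < κ → ∀ S : Set (Set Ordinal.{u}),
      Reflection.IsStationaryIn (Reflection.base κ) S →
      ∃ A : Set Reflection.Omega1.{u}, Reflection.IsTrace κ S A ∧
        ∃ (X : Set Ordinal.{u}) (N : Reflection.Omega1.{u} → Set Ordinal.{u}),
          Reflection.IsChainThrough κ S A X N := fun κ hκ S hS ↦ by
    obtain ⟨A, hA⟩ := hSRP.exists_isTrace hκ hS
    obtain ⟨D, hD, h⟩ := hSRP.exists_isChainThrough hκ hA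
    exact ⟨A ∩ D, hA.inter_isClub hκ hD, h⟩
  refine ⟨fun κ hκ S hS ↦ ?_, fun κ hκ S hS ↦
    ⟨key κ hκ S hS, fun A hA ↦ hSRP.exists_isChainThrough hκ hA⟩⟩
  obtain ⟨A, hA, X, N, h⟩ := key κ hκ S hS
  refine ⟨X, ?_, h.card, h.omega1_subset, h.isStationaryIn hA.stationary⟩
  rw [h.union]
  exact Set.iUnion_subset fun a ↦ (h.chain.mem a).1
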